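/- Let $\vec k=(k_1,\dots,k_n)$ be a vector of nonnegative integers. A $\vec k$-Dyck path $D$ is a lattice path from height $0$ to height $0$, never below height $0$, whose up steps are, in this order, $S^{k_1},\dots,S^{k_n}$ (red arrows), where $S^{k_i}=(1,k_i)$, and whose other steps are down steps $W=(1,-1)$ (blue arrows). Let $r_i$ be the height at which the $i$-th red arrow starts and $p_i$ the number of blue arrows before it. Put $\mathrm{area}(D)=r_1+\dots+r_n$. The statistic $\mathrm{bounce}(D)$ is defined by the bounce path: set $x_0=0$; in stage $s=0,1,2,\dots$ the bounce path, standing in column $x_s$, goes north and reaches all red arrows with $p_i\le x_s$ that have not been reached before (let $v_s$ be their number), and then goes east by $h_s$ units to column $x_{s+1}=x_s+h_s$, where $h_s$ is the number of indices $i$ such that the $i$-th red arrow was reached in a stage $\ell_i$ with $\ell_i\le s<\ell_i+k_i$. Then $\mathrm{bounce}(D)=\sum_{s\ge0}s\,v_s=\sum_{i=1}^n\ell_i$. Define $$C_{\vec k}(q,t)=\sum_{D}q^{\mathrm{area}(D)}t^{\mathrm{bounce}(D)}\in\mathbb Z[q,t],$$ where $D$ runs over all $\vec k$-Dyck paths,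 and write $k^4=(k,k,k,k)$. Then, for every integer $k\ge0$, $C_{k^4}(q,t)=C_{k^4}(t,q)$. Moreover, in $\mathbb Z[q,t][[x]]$, $$\sum_{k\ge0}C_{k^4}(q,t)\,x^k=\frac{N}{(1-q^3tx)(1-q^2t^2x)(1-qt^3x)(1-q^6x)(1-t^6x)},$$ where $$\begin{aligned}N={}&1+(q^5t+q^4t^2+q^3t^3+q^2t^4+qt^5+q^4t+q^3t^2+q^2t^3+qt^4)x\\&+(q^6t^5+q^5t^6-q^7t^3-q^6t^4-q^5t^5-q^4t^6-q^3t^7-q^5t^4-q^4t^5)x^2\\&-(q^8t^8+q^9t^6+q^8t^7+q^7t^8+q^6t^9)x^3.\end{aligned}$$ -/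

import Mathlib

namespace QTCatalan

/-- A step of a lattice path: a red arrow `S^k`, i.e. the up step `(1, k)`, or a blue arrow `W`,
i.e. the down step `(1, -1)`. -/
inductive Step where
  | red (k : ℕ) : Step
  | blue : Step
  deriving DecidableEq

namespace Step

/-- The change of height along a step. -/
def rise : Step → ℤ
  | red k => k
  | blue => -1

/-- The length `k` of a red arrow `S^k`; `none` for a blue arrow. -/
def label? : Step → Option ℕ
  | red k => some k
  | blue => none

end Step

/-- The height (rank) of the end point of a path that starts at height `0`. -/
def height (D : List Step) : ℤ := (D.map Step.rise).sum

/-- The lengths of the red arrows of a path, from left to right. -/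
def redLabels (D : List Step) : List ℕ := D.filterMap Step.label?

/-- `D` is a `k`-Dyck path, `k = (k₁, …, kₙ)`: its red arrows are `S^{k₁}, …, S^{kₙ}` in this order,
it never goes below height `0`, and it ends at height `0`. -/
def IsDyckPath (k : List ℕ) (D : List Step) : Prop :=
  redLabels D = k ∧ (∀ P : List Step, P <+: D → 0 ≤ height P) ∧ height D = 0

/-- The starting heights of the red arrows of a path that starts at height `r`. -/
def redRanksFrom : ℤ → List Step → List ℤ
  | _, [] => []
  | r, Step.red k :: D => r :: redRanksFrom (r + k) D
  | r, Step.blue :: D => redRanksFrom (r - 1) D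

/-- The red ranks `(r₁ = 0, r₂, …, rₙ)` of a path: the starting heights of its red arrows. -/
def redRanks (D : List Step) : List ℤ := redRanksFrom 0 D

/-- The area of a path: the sum of its red ranks (which are nonnegative for a Dyck path). -/
def area (D : List Step) : ℕ := (redRanks D).sum.toNat

/-- The pairs `(p, k)`, one for every red arrow `S^k` of the path, where `p` is `w` plus the number of
blue arrows before that red arrow. -/
def redArrowsFrom : ℕ → List Step → List (ℕ × ℕ)
  | _, [] => []
  | w, Step.red k :: D => (w, k) :: redArrowsFrom w D
  | w, Step.blue :: D => redArrowsFrom (w + 1) D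

/-- Draw a path with a unit north step for every red arrow and a unit east step for every blue arrow.
This lists, for every red arrow `S^k`, the pair `(p, k)` where `p` is the column of its north step,
i.e. the number of blue arrows before it. -/
def redArrows (D : List Step) : List (ℕ × ℕ) := redArrowsFrom 0 D

/-- One stage of the construction of the bounce path. `A` lists the pairs (column, length) of the red
arrows, and `e` records for every red arrow the number of unit east steps it has contributed to the
bounce path so far, so that the bounce path stands in column `e.sum`. It first goes north until it is
blocked by the path; thereafter exactly the red arrows in columns `≤ e.sum` have been reached. Then it
goes east, where every red arrow `S^k` that has been reached contributes one unit step, unless it has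
already contributed `k` of them. Thus `S^k` contributes to the `k` consecutive east moves
that start with the stage in which it is reached. -/
def bounceStage (A : List (ℕ × ℕ)) (e : List ℕ) : List ℕ :=
  List.zipWith (fun a c => if a.1 ≤ e.sum then min a.2 (c + 1) else c) A e

/-- The column in which the bounce path of `D` stands at the beginning of stage `i`, `i = 0, 1, …`. -/
def bounceColumn (D : List Step) (i : ℕ) : ℕ :=
  ((bounceStage (redArrows D))^[i] (List.replicate (redArrows D).length 0)).sum

/-- The stage in which the bounce path of `D` reaches the red arrows in column `p`. (For a Dyck path
every red arrow is reached.) -/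
noncomputable def bounceLevel (D : List Step) (p : ℕ) : ℕ := sInf {i : ℕ | p ≤ bounceColumn D i}

/-- The bounce statistic `∑ i, i * vᵢ`, where `vᵢ` is the number of red arrows that the bounce path
reaches in stage `i`, i.e. the sum over all red arrows of the stage in which they are reached. -/
noncomputable def bounce (D : List Step) : ℕ := ((redArrows D).map fun a => bounceLevel D a.1).sum

theorem perm_steps (D : List Step) :
    D.Perm ((redLabels D).map Step.red ++ List.replicate (D.count Step.blue) Step.blue) := by
  induction D with
  | nil => simp [redLabels]
  | cons s D ih =>
    cases s with
    | red k => simpa [redLabels, Step.label?] using ih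
    | blue =>
      have h : redLabels (Step.blue :: D) = redLabels D := rfl
      rw [h, List.count_cons_self, List.replicate_succ]
      exact (ih.cons _).trans List.perm_middle.symm

theorem height_eq (D : List Step) :
    height D = ((redLabels D).sum : ℤ) - (D.count Step.blue : ℤ) := by
  induction D with
  | nil => simp [redLabels, height]
  | cons s D ih =>
    have h : height (s :: D) = s.rise + height D := by simp [height]
    cases s with
    | red k =>
      have h1 : redLabels (Step.red k :: D) = k :: redLabels D := rfl
      rw [h, ih, h1, List.count_cons_of_ne (by simp)]
      simp [Step.rise]
      ring
    | blue =>
      have h1 : redLabels (Step.blue :: D) = redLabels D := rfl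
      rw [h, ih, h1, List.count_cons_self]
      simp [Step.rise]
      ring

theorem finite_dyckPaths (k : List ℕ) : {D : List Step | IsDyckPath k D}.Finite := by
  refine (List.finite_toSet
    (k.map Step.red ++ List.replicate k.sum Step.blue).permutations).subset ?_
  rintro D ⟨h1, -, h3⟩
  have h := height_eq D
  rw [h3, h1] at h
  have h' : D.count Step.blue = k.sum := by omega
  have := perm_steps D
  rw [h1, h'] at this
  exact List.mem_permutations.2 this

/-- The finite set of all `k`-Dyck paths. -/
noncomputable def dyckPaths (k : List ℕ) : Finset (List Step) := (finite_dyckPaths k).toFinset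

/-- The variable `q` of `ℤ[q, t]`. -/
noncomputable def q : MvPolynomial (Fin 2) ℤ := MvPolynomial.X 0

/-- The variable `t` of `ℤ[q, t]`. -/
noncomputable def t : MvPolynomial (Fin 2) ℤ := MvPolynomial.X 1

/-- The generalized `q,t`-Catalan number `C_k(q, t)`, the sum of `q ^ area D * t ^ bounce D` over all
`k`-Dyck paths `D`. -/
noncomputable def qtCatalan (k : List ℕ) : MvPolynomial (Fin 2) ℤ :=
  ∑ D ∈ dyckPaths k, q ^ area D * t ^ bounce D

/-- Exchange of `q` and `t`: sends `f(q, t)` to `f(t, q)`. -/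
noncomputable def swapQT (f : MvPolynomial (Fin 2) ℤ) : MvPolynomial (Fin 2) ℤ :=
  MvPolynomial.rename (Equiv.swap (0 : Fin 2) 1) f

/-- The generating function `∑_{k ≥ 0} C_{(k,k,k,k)}(q, t) x ^ k` in `ℤ[q, t][[x]]`. -/
noncomputable def genFun : PowerSeries (MvPolynomial (Fin 2) ℤ) :=
  PowerSeries.mk fun k => qtCatalan (List.replicate 4 k)

/-- The polynomial `N` in `x` over `ℤ[q, t]`, the numerator of the generating function. -/
noncomputable def numerator : Polynomial (MvPolynomial (Fin 2) ℤ) :=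
  1
  + Polynomial.C (q ^ 5 * t + q ^ 4 * t ^ 2 + q ^ 3 * t ^ 3 + q ^ 2 * t ^ 4 + q * t ^ 5
      + q ^ 4 * t + q ^ 3 * t ^ 2 + q ^ 2 * t ^ 3 + q * t ^ 4) * Polynomial.X
  + Polynomial.C (q ^ 6 * t ^ 5 + q ^ 5 * t ^ 6 - q ^ 7 * t ^ 3 - q ^ 6 * t ^ 4 - q ^ 5 * t ^ 5
      - q ^ 4 * t ^ 6 - q ^ 3 * t ^ 7 - q ^ 5 * t ^ 4 - q ^ 4 * t ^ 5) * Polynomial.X ^ 2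
  - Polynomial.C (q ^ 8 * t ^ 8 + q ^ 9 * t ^ 6 + q ^ 8 * t ^ 7 + q ^ 7 * t ^ 8 + q ^ 6 * t ^ 9)
      * Polynomial.X ^ 3

/-- The factor `1 - q ^ i * t ^ j * x` of the denominator of the generating function. -/
noncomputable def factor (i j : ℕ) : Polynomial (MvPolynomial (Fin 2) ℤ) :=
  1 - Polynomial.C (q ^ i * t ^ j) * Polynomial.X

/-- The denominator of the generating function, a polynomial in `x` with constant term `1`. -/
noncomputable def denominator : Polynomial (MvPolynomial (Fin 2) ℤ) :=
  factor 3 1 * factor 2 2 * factor 1 3 * factor 6 0 * factor 0 6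

end QTCatalan

namespace QTCatalan

/-! A path with four red arrows of length `k` is a triple `a ≤ b ≤ c` of columns with `a ≤ k`, `b ≤
2k`, `c ≤ 3k`, and its area is `6k - a - b - c`. The bounce path advances in each stage by the
number of red arrows still contributing. Hence the second arrow is reached in stage `a`, and the
stages `l₃`, `l₄` of the other two depend piecewise linearly on the columns (`bounce_fourPath`).

Grouping the triples by stages instead of columns, the columns reached in one stage at speed 2 or 3
contribute a factor `1 + q` or `1 + q + q²`. What remains is eleven families of chains bounded by
`k`, each weighted by a monomial whose exponents are linear in the chain (`sum_weight_left`,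
`sum_weight_middle`, `sum_weight_right`). Such a monomial is a product of powers over the gaps of
the chain, so each family has a product of geometric series as its generating function.

Adding the eleven products gives the rational function (`rational_identity`). Its numerator and
denominator are invariant under exchanging `q` and `t`, which gives the symmetry of every
coefficient. -/

/-! ### Dyck paths with four equal red arrows as triples of columns -/

theorem height_append (P Q : List Step) : height (P ++ Q) = height P + height Q := by
  simp [height]

theorem redLabels_eq_nil {D : List Step} (h : redLabels D = []) :
    D = List.replicate D.length Step.blue := by
  refine List.eq_replicate_iff.2 ⟨rfl, fun s hs => ?_⟩
  cases s with
  | blue => rfl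
  | red k =>
    have : k ∈ redLabels D := List.mem_filterMap.2 ⟨_, hs, rfl⟩
    simp [h] at this

theorem exists_of_redLabels_eq_cons {D : List Step} {k : ℕ} {l : List ℕ}
    (h : redLabels D = k :: l) :
    ∃ n D', D = List.replicate n Step.blue ++ Step.red k :: D' ∧ redLabels D' = l := by
  induction D with
  | nil => simp [redLabels] at h
  | cons s D ih =>
    cases s with
    | red m =>
      have h1 : redLabels (Step.red m :: D) = m :: redLabels D := rfl
      rw [h1, List.cons.injEq] at h
      exact ⟨0, D, by simp [h.1], h.2⟩
    | blue =>
      obtain ⟨n, D', hD, hl⟩ := ih h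
      exact ⟨n + 1, D', by simp [hD, List.replicate_succ], hl⟩

/-- A path that starts at height `r` stays weakly above height `0`. -/
def NonnegFrom (r : ℤ) (D : List Step) : Prop :=
  ∀ P : List Step, P <+: D → 0 ≤ r + height P

theorem nonnegFrom_nil (r : ℤ) : NonnegFrom r [] ↔ 0 ≤ r := by
  simp [NonnegFrom, height]

theorem nonnegFrom_cons (r : ℤ) (s : Step) (D : List Step) :
    NonnegFrom r (s :: D) ↔ 0 ≤ r ∧ NonnegFrom (r + s.rise) D := by
  constructor
  · intro h
    refine ⟨by simpa [height] using h [] List.nil_prefix, fun P hP => ?_⟩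
    have := h (s :: P) (by simpa using hP)
    simpa [height, add_assoc] using this
  · rintro ⟨h0, h⟩ P hP
    cases P with
    | nil => simpa [height] using h0
    | cons s' P =>
      rw [List.cons_prefix_cons] at hP
      obtain ⟨rfl, hP⟩ := hP
      simpa [height, add_assoc] using h P hP

theorem nonnegFrom_replicate_blue (r : ℤ) (n : ℕ) (D : List Step) :
    NonnegFrom r (List.replicate n Step.blue ++ D) ↔
      (0 < n → 0 ≤ r) ∧ NonnegFrom (r - n) D := by
  induction n generalizing r with
  | zero => simp
  | succ n ih =>
    rw [List.replicate_succ, List.cons_append, nonnegFrom_cons, ih]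
    have e : r + Step.blue.rise - (n : ℤ) = r - ((n + 1 : ℕ) : ℤ) := by
      simp [Step.rise]; ring
    rw [e]
    constructor
    · rintro ⟨h, -, h'⟩
      exact ⟨fun _ => h, h'⟩
    · rintro ⟨h, h'⟩
      refine ⟨h (by simp), fun hn => ?_, h'⟩
      have := h' [] List.nil_prefix
      simp [height] at this
      simp [Step.rise]
      omega

/-- The path with four red arrows of length `k`, which are preceded by `0`, `a`, `b` and `c` blue
arrows, and `4 * k` blue arrows. -/
def fourPath (k a b c : ℕ) : List Step :=
  Step.red k :: (List.replicate a Step.blue ++ Step.red k :: (List.replicate (b - a) Step.blue ++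
    Step.red k :: (List.replicate (c - b) Step.blue ++ Step.red k ::
      (List.replicate (4 * k - c) Step.blue ++ []))))

theorem redArrowsFrom_replicate_blue (w n : ℕ) (D : List Step) :
    redArrowsFrom w (List.replicate n Step.blue ++ D) = redArrowsFrom (w + n) D := by
  induction n generalizing w with
  | zero => simp
  | succ n ih =>
    rw [List.replicate_succ, List.cons_append, redArrowsFrom, ih]
    congr 1
    omega

theorem redRanksFrom_replicate_blue (r : ℤ) (n : ℕ) (D : List Step) :
    redRanksFrom r (List.replicate n Step.blue ++ D) = redRanksFrom (r - n) D := by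
  induction n generalizing r with
  | zero => simp
  | succ n ih =>
    rw [List.replicate_succ, List.cons_append, redRanksFrom, ih]
    congr 1
    push_cast
    ring

theorem redLabels_replicate_blue (n : ℕ) (D : List Step) :
    redLabels (List.replicate n Step.blue ++ D) = redLabels D := by
  induction n with
  | zero => simp
  | succ n ih => rw [List.replicate_succ, List.cons_append]; exact ih

theorem redLabels_red_cons (k : ℕ) (D : List Step) :
    redLabels (Step.red k :: D) = k :: redLabels D := rfl

theorem height_red_cons (k : ℕ) (D : List Step) : height (Step.red k :: D) = k + height D := by
  simp [height, Step.rise]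

theorem height_replicate_blue (n : ℕ) : height (List.replicate n Step.blue) = -n := by
  simp [height, Step.rise]

theorem redArrows_fourPath {k a b c : ℕ} (hab : a ≤ b) (hbc : b ≤ c) :
    redArrows (fourPath k a b c) = [(0, k), (a, k), (b, k), (c, k)] := by
  simp only [redArrows, fourPath, redArrowsFrom, redArrowsFrom_replicate_blue]
  rw [zero_add, Nat.add_sub_cancel' hab, Nat.add_sub_cancel' hbc]

theorem area_fourPath {k a b c : ℕ} (hab : a ≤ b) (hbc : b ≤ c) :
    area (fourPath k a b c) = 6 * k - (a + b + c) := by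
  simp only [area, redRanks, fourPath, redRanksFrom, redRanksFrom_replicate_blue]
  simp only [List.sum_cons, List.sum_nil]
  omega

/-- The height is lowest at the ends of the blue runs, which yields the three bounds. The last run
is forced by the return to height `0`. -/
theorem isDyckPath_replicate_four_iff {k : ℕ} {D : List Step} :
    IsDyckPath (List.replicate 4 k) D ↔
      ∃ a b c, a ≤ k ∧ a ≤ b ∧ b ≤ 2 * k ∧ b ≤ c ∧ c ≤ 3 * k ∧ D = fourPath k a b c := by
  have hiff : (∀ P : List Step, P <+: D → 0 ≤ height P) ↔ NonnegFrom 0 D := by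
    simp [NonnegFrom]
  rw [IsDyckPath, hiff]
  constructor
  · rintro ⟨hl, hn, hh⟩
    obtain ⟨n₁, D₁, rfl, hl₁⟩ := exists_of_redLabels_eq_cons hl
    obtain ⟨n₂, D₂, rfl, hl₂⟩ := exists_of_redLabels_eq_cons hl₁
    obtain ⟨n₃, D₃, rfl, hl₃⟩ := exists_of_redLabels_eq_cons hl₂
    obtain ⟨n₄, D₄, rfl, hl₄⟩ := exists_of_redLabels_eq_cons hl₃
    clear hiff hl hl₁ hl₂ hl₃
    rw [redLabels_eq_nil hl₄] at hh hn ⊢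
    generalize D₄.length = n₅ at hh hn ⊢
    simp only [height_append, height_red_cons, height_replicate_blue] at hh
    rw [← List.append_nil (List.replicate n₅ _)] at hn
    simp only [nonnegFrom_replicate_blue, nonnegFrom_cons, nonnegFrom_nil, Step.rise] at hn
    -- A blue arrow before the first red one would start at height `0`.
    have h1 : n₁ = 0 := by omega
    subst h1
    refine ⟨n₂, n₂ + n₃, n₂ + n₃ + n₄, by omega, by omega, by omega, by omega, by omega, ?_⟩
    have h5 : n₅ = 4 * k - (n₂ + n₃ + n₄) := by omega
    simp [fourPath, h5]
  · rintro ⟨a, b, c, ha, hab, hb, hbc, hc, rfl⟩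
    refine ⟨?_, ?_, ?_⟩
    · simp only [fourPath, redLabels_red_cons, redLabels_replicate_blue]
      rfl
    · simp only [fourPath, nonnegFrom_replicate_blue, nonnegFrom_cons, nonnegFrom_nil, Step.rise]
      omega
    · simp only [fourPath, height_append, height_red_cons, height_replicate_blue, List.append_nil]
      omega

theorem qtCatalan_replicate_four (k : ℕ) :
    qtCatalan (List.replicate 4 k) =
      ∑ a ∈ Finset.Icc 0 k, ∑ b ∈ Finset.Icc a (2 * k), ∑ c ∈ Finset.Icc b (3 * k),
        q ^ (6 * k - (a + b + c)) * t ^ bounce (fourPath k a b c) := by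
  rw [qtCatalan]
  simp only [Finset.sum_sigma']
  symm
  refine Finset.sum_bij (fun x _ => fourPath k x.1 x.2.1 x.2.2) ?_ ?_ ?_ ?_
  · rintro ⟨a, b, c⟩ h
    simp only [Finset.mem_sigma, Finset.mem_Icc] at h
    simp only [dyckPaths, Set.Finite.mem_toFinset, Set.mem_ofPred_eq]
    exact isDyckPath_replicate_four_iff.2 ⟨a, b, c, by omega, by omega, by omega, by omega,
      by omega, rfl⟩
  · rintro ⟨a, b, c⟩ h ⟨a', b', c'⟩ h' e
    simp only [Finset.mem_sigma, Finset.mem_Icc] at h h'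
    have e' := congrArg redArrows e
    dsimp only at e'
    rw [redArrows_fourPath (by omega) (by omega), redArrows_fourPath (by omega) (by omega)] at e'
    simp only [List.cons.injEq, Prod.mk.injEq] at e'
    obtain ⟨-, ⟨rfl, -⟩, ⟨rfl, -⟩, ⟨rfl, -⟩, -⟩ := e'
    rfl
  · intro D hD
    simp only [dyckPaths, Set.Finite.mem_toFinset, Set.mem_ofPred_eq] at hD
    obtain ⟨a, b, c, ha, hab, hb, hbc, hc, rfl⟩ := isDyckPath_replicate_four_iff.1 hD
    exact ⟨⟨a, b, c⟩, by simp only [Finset.mem_sigma, Finset.mem_Icc]; omega, rfl⟩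
  · rintro ⟨a, b, c⟩ h
    simp only [Finset.mem_sigma, Finset.mem_Icc] at h
    dsimp only
    rw [area_fourPath (by omega) (by omega)]

/-- Suppose that `l₂`, `l₃`, `l₄` solve the implicit equations that describe the stages in which the
second, third and fourth red arrow are reached. Then they are these stages. -/
theorem bounce_fourPath {k a b c l₂ l₃ l₄ : ℕ} (hab : a ≤ b) (hbc : b ≤ c)
    (h₂ : ∀ i, a ≤ min k i + min k (i - l₂) + min k (i - l₃) + min k (i - l₄) ↔ l₂ ≤ i)
    (h₃ : ∀ i, b ≤ min k i + min k (i - l₂) + min k (i - l₃) + min k (i - l₄) ↔ l₃ ≤ i)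
    (h₄ : ∀ i, c ≤ min k i + min k (i - l₂) + min k (i - l₃) + min k (i - l₄) ↔ l₄ ≤ i) :
    bounce (fourPath k a b c) = l₂ + l₃ + l₄ := by
  have hA := redArrows_fourPath (k := k) hab hbc
  -- An arrow reached in stage `l` has contributed `min k (i - l)` steps before stage `i`; truncated
  -- subtraction gives `0` as long as it is not reached.
  have hit : ∀ i, (bounceStage [(0, k), (a, k), (b, k), (c, k)])^[i] [0, 0, 0, 0] =
      [min k i, min k (i - l₂), min k (i - l₃), min k (i - l₄)] := by
    intro i
    induction i with
    | zero => simp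
    | succ i ih =>
      rw [Function.iterate_succ_apply', ih]
      have hs : [min k i, min k (i - l₂), min k (i - l₃), min k (i - l₄)].sum =
          min k i + min k (i - l₂) + min k (i - l₃) + min k (i - l₄) := by
        simp [add_assoc]
      simp only [bounceStage, hs, List.zipWith_cons_cons, List.zipWith_nil_left, h₂, h₃, h₄,
        Nat.zero_le, if_true, List.cons.injEq, and_true]
      refine ⟨by omega, ?_, ?_, ?_⟩ <;> split_ifs <;> omega
  have hcol : ∀ i, bounceColumn (fourPath k a b c) i =
      min k i + min k (i - l₂) + min k (i - l₃) + min k (i - l₄) := by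
    intro i
    have := hit i
    simp only [bounceColumn, hA, List.length_cons, List.length_nil, List.replicate] at this ⊢
    rw [this]
    simp [add_assoc]
  have hIci : ∀ n : ℕ, sInf {i : ℕ | n ≤ i} = n := fun n => csInf_Ici
  have h₀ : bounceLevel (fourPath k a b c) 0 = 0 := by simp [bounceLevel]
  simp only [bounce, hA, List.map_cons, List.map_nil, h₀]
  simp only [bounceLevel, hcol, h₂, h₃, h₄, hIci, List.sum_cons, List.sum_nil]
  omega

/-! ### Summation over columns, stage by stage -/

open Finset

/-- At speed 3 the bounce path passes three columns per stage: `c` is the stage, and the three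
summands are the columns first reached in it. The next two lemmas serve speeds 2 and 1. -/
theorem sum_Ioc_three_mul {M : Type*} [AddCommMonoid M] (f : ℕ → M) (A : ℕ) {a b : ℕ}
    (h : a ≤ b) :
    ∑ p ∈ Ioc A (A + 3 * (b - a)), f p =
      ∑ c ∈ Ioc a b, (f (A + 3 * (c - a)) + f (A + 3 * (c - a) - 1) + f (A + 3 * (c - a) - 2)) := by
  induction b, h using Nat.le_induction with
  | base => simp
  | succ b h ih =>
    rw [sum_Ioc_succ_top (by omega), ← ih]
    have e : A + 3 * (b + 1 - a) = A + 3 * (b - a) + 1 + 1 + 1 := by omega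
    rw [e, sum_Ioc_succ_top (by omega), sum_Ioc_succ_top (by omega), sum_Ioc_succ_top (by omega)]
    rw [add_assoc, add_assoc, ← add_assoc (f _) (f _) (f _), add_comm _ (f (_ + 1 + 1 + 1)),
      add_comm (f _) (f (_ + 1 + 1)), add_assoc, ← add_assoc (f _) (f _) (f _)]
    rfl

theorem sum_Ioc_two_mul {M : Type*} [AddCommMonoid M] (f : ℕ → M) (A : ℕ) {a b : ℕ}
    (h : a ≤ b) :
    ∑ p ∈ Ioc A (A + 2 * (b - a)), f p =
      ∑ c ∈ Ioc a b, (f (A + 2 * (c - a)) + f (A + 2 * (c - a) - 1)) := by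
  induction b, h using Nat.le_induction with
  | base => simp
  | succ b h ih =>
    rw [sum_Ioc_succ_top (by omega), ← ih]
    have e : A + 2 * (b + 1 - a) = A + 2 * (b - a) + 1 + 1 := by omega
    rw [e, sum_Ioc_succ_top (by omega), sum_Ioc_succ_top (by omega), add_assoc, add_comm (f _)]
    rfl

theorem sum_Ioc_add_sub {M : Type*} [AddCommMonoid M] (f : ℕ → M) (A : ℕ) {a b : ℕ}
    (h : a ≤ b) :
    ∑ p ∈ Ioc A (A + (b - a)), f p = ∑ c ∈ Ioc a b, f (A + (c - a)) := by
  induction b, h using Nat.le_induction with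
  | base => simp
  | succ b h ih =>
    rw [sum_Ioc_succ_top (by omega), ← ih]
    have e : A + (b + 1 - a) = A + (b - a) + 1 := by omega
    rw [e, sum_Ioc_succ_top (by omega)]

/-- The monomial `q ^ i * t ^ j`. -/
noncomputable def qtMonomial (i j : ℕ) : MvPolynomial (Fin 2) ℤ := q ^ i * t ^ j

/-- The contribution of a path to the `q,t`-Catalan number. -/
noncomputable def weight (k a b c : ℕ) : MvPolynomial (Fin 2) ℤ :=
  q ^ (6 * k - (a + b + c)) * t ^ bounce (fourPath k a b c)

/-- Here `m` counts by how many columns the third and fourth arrows together fall short of reference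
columns for their stages; each such column adds one to the area and leaves the bounce unchanged. For
concrete columns all hypotheses are piecewise linear, so `omega` decides them. -/
theorem weight_eq {k a b c l₃ l₄ m e f : ℕ} (hab : a ≤ b) (hbc : b ≤ c)
    (h₂ : ∀ i, a ≤ min k i + min k (i - a) + min k (i - l₃) + min k (i - l₄) ↔ a ≤ i)
    (h₃ : ∀ i, b ≤ min k i + min k (i - a) + min k (i - l₃) + min k (i - l₄) ↔ l₃ ≤ i)
    (h₄ : ∀ i, c ≤ min k i + min k (i - a) + min k (i - l₃) + min k (i - l₄) ↔ l₄ ≤ i)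
    (he : 6 * k - (a + b + c) = m + e) (hf : a + l₃ + l₄ = f) :
    weight k a b c = q ^ m * qtMonomial e f := by
  rw [weight, bounce_fourPath hab hbc h₂ h₃ h₄, he, hf, qtMonomial]
  ring

theorem sum_Icc_eq_add_sum_Ioc {M : Type*} [AddCommMonoid M] (f : ℕ → M) {a b : ℕ} (h : a ≤ b) :
    ∑ p ∈ Icc a b, f p = f a + ∑ p ∈ Ioc a b, f p := by
  rw [← Ioc_insert_left h, sum_insert (by simp)]

/-- Case `l₃ = a`. From stage `a` on the speed is 3 until the first arrow is exhausted in stage `k`,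
then 2 until stage `k + a`. -/
theorem sum_weight_left {k a : ℕ} (ha : a ≤ k) :
    ∑ c ∈ Icc a (3 * k), weight k a a c =
      qtMonomial (6 * k - 3 * a) (3 * a) +
      ∑ c ∈ Ioc a k, (1 + q + q ^ 2) * qtMonomial (6 * k - 3 * c) (2 * a + c) +
      ∑ c ∈ Ioc 0 a, (1 + q) * qtMonomial (3 * k - 2 * c) (2 * a + k + c) := by
  have e : 3 * k = a + 3 * (k - a) + 2 * (a - 0) := by omega
  rw [sum_Icc_eq_add_sum_Ioc _ (by omega),
    ← sum_Ioc_consecutive _ (show a ≤ a + 3 * (k - a) by omega) (by omega)]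
  nth_rw 1 [e]
  rw [sum_Ioc_three_mul _ _ ha, sum_Ioc_two_mul _ _ (Nat.zero_le a), ← add_assoc]
  congr 1
  · congr 1
    · rw [weight_eq (m := 0) (l₃ := a) (l₄ := a) (e := 6 * k - 3 * a) (f := 3 * a)]
      · ring
      all_goals omega
    · refine sum_congr rfl fun c hc => ?_
      rw [mem_Ioc] at hc
      rw [weight_eq (m := 0) (l₃ := a) (l₄ := c) (e := 6 * k - 3 * c) (f := 2 * a + c),
        weight_eq (m := 1) (l₃ := a) (l₄ := c) (e := 6 * k - 3 * c) (f := 2 * a + c),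
        weight_eq (m := 2) (l₃ := a) (l₄ := c) (e := 6 * k - 3 * c) (f := 2 * a + c)]
      · ring
      all_goals omega
  · refine sum_congr rfl fun c hc => ?_
    rw [mem_Ioc] at hc
    rw [weight_eq (m := 0) (l₃ := a) (l₄ := k + c) (e := 3 * k - 2 * c) (f := 2 * a + k + c),
      weight_eq (m := 1) (l₃ := a) (l₄ := k + c) (e := 3 * k - 2 * c) (f := 2 * a + k + c)]
    · ring
    all_goals omega

/-- Case `l₃ = b` with `a < b ≤ k`: at speed 2, stage `b` reaches the columns `2b - a` and `2b - a -
1`, whence `1 + q`. Up to stage `k` the fourth arrow is met at speed 3, whence `1 + q + q²`. -/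
theorem sum_weight_middle_of_le {k a b : ℕ} (hab : a < b) (hb : b ≤ k) :
    ∑ c ∈ Ioc b k, (1 + q) * (1 + q + q ^ 2) *
        qtMonomial (6 * k + a - b - 3 * c) (a + b + c) =
      ∑ c ∈ Ioc b k, (weight k a (2 * b - a) (2 * b - a + 3 * (c - b)) +
        weight k a (2 * b - a) (2 * b - a + 3 * (c - b) - 1) +
        weight k a (2 * b - a) (2 * b - a + 3 * (c - b) - 2)) +
      ∑ c ∈ Ioc b k, (weight k a (2 * b - a - 1) (2 * b - a + 3 * (c - b)) +
        weight k a (2 * b - a - 1) (2 * b - a + 3 * (c - b) - 1) +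
        weight k a (2 * b - a - 1) (2 * b - a + 3 * (c - b) - 2)) := by
  rw [← sum_add_distrib]
  refine sum_congr rfl fun c hc => ?_
  rw [mem_Ioc] at hc
  rw [weight_eq (m := 0) (l₃ := b) (l₄ := c) (e := 6 * k + a - b - 3 * c)
      (f := a + b + c),
    weight_eq (m := 1) (l₃ := b) (l₄ := c) (e := 6 * k + a - b - 3 * c)
      (f := a + b + c),
    weight_eq (m := 2) (l₃ := b) (l₄ := c) (e := 6 * k + a - b - 3 * c)
      (f := a + b + c),
    weight_eq (m := 1) (l₃ := b) (l₄ := c) (e := 6 * k + a - b - 3 * c)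
      (f := a + b + c),
    weight_eq (m := 2) (l₃ := b) (l₄ := c) (e := 6 * k + a - b - 3 * c)
      (f := a + b + c),
    weight_eq (m := 3) (l₃ := b) (l₄ := c) (e := 6 * k + a - b - 3 * c)
      (f := a + b + c)]
  · ring
  all_goals omega

/-- Between stages `k` and `k + a` only the second and third arrows contribute. -/
theorem sum_weight_middle_of_lt_add_left {k a b : ℕ} (hab : a < b) (hb : b ≤ k) :
    ∑ c ∈ Ioc 0 a, (1 + q) ^ 2 *
        qtMonomial (3 * k + a - b - 2 * c) (a + b + k + c) =
      ∑ c ∈ Ioc 0 a, (weight k a (2 * b - a) (2 * b - a + 3 * (k - b) + 2 * (c - 0)) +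
        weight k a (2 * b - a) (2 * b - a + 3 * (k - b) + 2 * (c - 0) - 1)) +
      ∑ c ∈ Ioc 0 a, (weight k a (2 * b - a - 1) (2 * b - a + 3 * (k - b) + 2 * (c - 0)) +
        weight k a (2 * b - a - 1) (2 * b - a + 3 * (k - b) + 2 * (c - 0) - 1)) := by
  rw [← sum_add_distrib]
  refine sum_congr rfl fun c hc => ?_
  rw [mem_Ioc] at hc
  rw [weight_eq (m := 0) (l₃ := b) (l₄ := k + c) (e := 3 * k + a - b - 2 * c)
      (f := a + b + k + c),
    weight_eq (m := 1) (l₃ := b) (l₄ := k + c) (e := 3 * k + a - b - 2 * c)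
      (f := a + b + k + c),
    weight_eq (m := 1) (l₃ := b) (l₄ := k + c) (e := 3 * k + a - b - 2 * c)
      (f := a + b + k + c),
    weight_eq (m := 2) (l₃ := b) (l₄ := k + c) (e := 3 * k + a - b - 2 * c)
      (f := a + b + k + c)]
  · ring
  all_goals omega

/-- Between stages `k + a` and `k + b` only the third arrow contributes. -/
theorem sum_weight_middle_of_lt_add_right {k a b : ℕ} (hab : a < b) (hb : b ≤ k) :
    ∑ c ∈ Ioc a b, (1 + q) * qtMonomial (3 * k - b - c) (a + b + k + c) =
      ∑ c ∈ Ioc a b,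
        weight k a (2 * b - a) (2 * b - a + 3 * (k - b) + 2 * (a - 0) + (c - a)) +
      ∑ c ∈ Ioc a b,
        weight k a (2 * b - a - 1) (2 * b - a + 3 * (k - b) + 2 * (a - 0) + (c - a)) := by
  rw [← sum_add_distrib]
  refine sum_congr rfl fun c hc => ?_
  rw [mem_Ioc] at hc
  rw [weight_eq (m := 0) (l₃ := b) (l₄ := k + c) (e := 3 * k - b - c) (f := a + b + k + c),
    weight_eq (m := 1) (l₃ := b) (l₄ := k + c) (e := 3 * k - b - c) (f := a + b + k + c)]
  · ring
  all_goals omega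

theorem sum_weight_middle {k a b : ℕ} (hab : a < b) (hb : b ≤ k) :
    ∑ c ∈ Icc (2 * b - a) (3 * k), weight k a (2 * b - a) c +
      ∑ c ∈ Icc (2 * b - a - 1) (3 * k), weight k a (2 * b - a - 1) c =
      (1 + q + q ^ 2) * qtMonomial (6 * k + a - 4 * b) (a + 2 * b) +
      ∑ c ∈ Ioc b k, (1 + q) * (1 + q + q ^ 2) *
        qtMonomial (6 * k + a - b - 3 * c) (a + b + c) +
      ∑ c ∈ Ioc 0 a, (1 + q) ^ 2 * qtMonomial (3 * k + a - b - 2 * c) (a + b + k + c) +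
      ∑ c ∈ Ioc a b, (1 + q) * qtMonomial (3 * k - b - c) (a + b + k + c) := by
  have e : 3 * k = 2 * b - a + 3 * (k - b) + 2 * (a - 0) + (b - a) := by omega
  have split (f : ℕ → MvPolynomial (Fin 2) ℤ) : ∑ c ∈ Ioc (2 * b - a) (3 * k), f c =
      ∑ c ∈ Ioc b k, (f (2 * b - a + 3 * (c - b)) + f (2 * b - a + 3 * (c - b) - 1) +
        f (2 * b - a + 3 * (c - b) - 2)) +
      ∑ c ∈ Ioc 0 a, (f (2 * b - a + 3 * (k - b) + 2 * (c - 0)) +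
        f (2 * b - a + 3 * (k - b) + 2 * (c - 0) - 1)) +
      ∑ c ∈ Ioc a b, f (2 * b - a + 3 * (k - b) + 2 * (a - 0) + (c - a)) := by
    rw [← sum_Ioc_consecutive _ (show 2 * b - a ≤ 2 * b - a + 3 * (k - b) + 2 * (a - 0) by omega)
        (by omega),
      ← sum_Ioc_consecutive _ (show 2 * b - a ≤ 2 * b - a + 3 * (k - b) by omega) (by omega)]
    nth_rw 1 [e]
    rw [sum_Ioc_three_mul _ _ hb, sum_Ioc_two_mul _ _ (Nat.zero_le a), sum_Ioc_add_sub _ _ hab.le]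
  rw [sum_Icc_eq_add_sum_Ioc _ (show 2 * b - a ≤ 3 * k by omega),
    sum_Icc_eq_add_sum_Ioc _ (show 2 * b - a - 1 ≤ 3 * k by omega),
    ← sum_Ioc_consecutive _ (show 2 * b - a - 1 ≤ 2 * b - a by omega) (by omega), split, split]
  have one : ∑ c ∈ Ioc (2 * b - a - 1) (2 * b - a), weight k a (2 * b - a - 1) c =
      weight k a (2 * b - a - 1) (2 * b - a) := by
    rw [show Ioc (2 * b - a - 1) (2 * b - a) = {2 * b - a} by ext; simp; omega, sum_singleton]
  rw [one]
  -- Third and fourth arrow reached together in stage `b`: the column pairs with `2b - a - 1 ≤ third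
  -- ≤ fourth ≤ 2b - a` number three.
  have h₀ : weight k a (2 * b - a) (2 * b - a) + weight k a (2 * b - a - 1) (2 * b - a - 1) +
      weight k a (2 * b - a - 1) (2 * b - a) =
      (1 + q + q ^ 2) * qtMonomial (6 * k + a - 4 * b) (a + 2 * b) := by
    rw [weight_eq (m := 0) (l₃ := b) (l₄ := b) (e := 6 * k + a - 4 * b) (f := a + 2 * b),
      weight_eq (m := 2) (l₃ := b) (l₄ := b) (e := 6 * k + a - 4 * b) (f := a + 2 * b),
      weight_eq (m := 1) (l₃ := b) (l₄ := b) (e := 6 * k + a - 4 * b) (f := a + 2 * b)]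
    · ring
    all_goals omega
  rw [← h₀]
  rw [sum_weight_middle_of_le hab hb, sum_weight_middle_of_lt_add_left hab hb,
    sum_weight_middle_of_lt_add_right hab hb]
  abel

/-- Case `l₃ = k + b`, at speed 1 with a single possible column. The fourth arrow is met at speed 2
up to stage `k + a`, then at speed 1 up to stage `2k + b`; the latter range is cut at stage `2k` so
that each piece is a chain bounded by `k`. -/
theorem sum_weight_right {k a b : ℕ} (ha : a ≤ k) (hb : 0 < b) (hba : b ≤ a) :
    ∑ c ∈ Icc (2 * k + b - a) (3 * k), weight k a (2 * k + b - a) c =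
      qtMonomial (2 * k + a - 2 * b) (a + 2 * k + 2 * b) +
      ∑ c ∈ Ioc b a, (1 + q) * qtMonomial (2 * k + a - 2 * c) (a + b + 2 * k + c) +
      ∑ c ∈ Ioc a k, qtMonomial (2 * k - c) (a + b + 2 * k + c) +
      ∑ c ∈ Ioc 0 b, qtMonomial (k - c) (a + b + 3 * k + c) := by
  have e : 3 * k = 2 * k + b - a + 2 * (a - b) + (k - a) + (b - 0) := by omega
  rw [sum_Icc_eq_add_sum_Ioc _ (by omega),
    ← sum_Ioc_consecutive _
      (show 2 * k + b - a ≤ 2 * k + b - a + 2 * (a - b) + (k - a) by omega) (by omega),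
    ← sum_Ioc_consecutive _
      (show 2 * k + b - a ≤ 2 * k + b - a + 2 * (a - b) by omega) (by omega)]
  nth_rw 1 [e]
  rw [sum_Ioc_two_mul _ _ hba, sum_Ioc_add_sub _ _ ha, sum_Ioc_add_sub _ _ (Nat.zero_le b),
    ← add_assoc, ← add_assoc]
  congr 1
  · congr 1
    · congr 1
      · rw [weight_eq (m := 0) (l₃ := k + b) (l₄ := k + b) (e := 2 * k + a - 2 * b)
          (f := a + 2 * k + 2 * b)]
        · ring
        all_goals omega
      · refine sum_congr rfl fun c hc => ?_
        rw [mem_Ioc] at hc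
        rw [weight_eq (m := 0) (l₃ := k + b) (l₄ := k + c) (e := 2 * k + a - 2 * c)
            (f := a + b + 2 * k + c),
          weight_eq (m := 1) (l₃ := k + b) (l₄ := k + c) (e := 2 * k + a - 2 * c)
            (f := a + b + 2 * k + c)]
        · ring
        all_goals omega
    · refine sum_congr rfl fun c hc => ?_
      rw [mem_Ioc] at hc
      rw [weight_eq (m := 0) (l₃ := k + b) (l₄ := k + c) (e := 2 * k - c)
        (f := a + b + 2 * k + c)]
      · ring
      all_goals omega
  · refine sum_congr rfl fun c hc => ?_
    rw [mem_Ioc] at hc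
    rw [weight_eq (m := 0) (l₃ := k + b) (l₄ := 2 * k + c) (e := k - c)
      (f := a + b + 3 * k + c)]
    · ring
    all_goals omega

/-- The third arrow is reached in stage `a`, at speed 2 in a stage up to `k`, or at speed 1 after
stage `k`. -/
theorem qtCatalan_replicate_four_eq_sum_weight (k : ℕ) :
    qtCatalan (List.replicate 4 k) = ∑ a ∈ Icc 0 k,
      (∑ c ∈ Icc a (3 * k), weight k a a c +
      ∑ b ∈ Ioc a k, (∑ c ∈ Icc (2 * b - a) (3 * k), weight k a (2 * b - a) c +
        ∑ c ∈ Icc (2 * b - a - 1) (3 * k), weight k a (2 * b - a - 1) c) +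
      ∑ b ∈ Ioc 0 a, ∑ c ∈ Icc (2 * k + b - a) (3 * k), weight k a (2 * k + b - a) c) := by
  rw [qtCatalan_replicate_four]
  refine sum_congr rfl fun a ha => ?_
  rw [mem_Icc] at ha
  have split (f : ℕ → MvPolynomial (Fin 2) ℤ) : ∑ b ∈ Icc a (2 * k), f b =
      f a + ∑ b ∈ Ioc a k, (f (2 * b - a) + f (2 * b - a - 1)) +
        ∑ b ∈ Ioc 0 a, f (2 * k + b - a) := by
    rw [sum_Icc_eq_add_sum_Ioc _ (by omega),
      ← sum_Ioc_consecutive _ (show a ≤ a + 2 * (k - a) by omega) (by omega)]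
    nth_rw 1 [show 2 * k = a + 2 * (k - a) + (a - 0) by omega]
    rw [sum_Ioc_two_mul _ _ ha.2, sum_Ioc_add_sub _ _ (Nat.zero_le a), ← add_assoc]
    congr 1
    · congr 1
      refine sum_congr rfl fun c hc => ?_
      rw [mem_Ioc] at hc
      rw [show a + 2 * (c - a) = 2 * c - a by omega]
    · refine sum_congr rfl fun c hc => ?_
      rw [show a + 2 * (k - a) + (c - 0) = 2 * k + c - a by omega]
  exact split fun b => ∑ c ∈ Icc b (3 * k), weight k a b c

/-! ### Geometric series and chains -/

section Geometric

variable {R : Type*} [CommRing R]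

/-- The geometric series `∑_{n ≥ 0} m ^ n * X ^ n`. -/
def geom (m : R) : PowerSeries R := PowerSeries.mk fun n => m ^ n

/-- The geometric series `∑_{n ≥ 1} m ^ n * X ^ n` without its constant term. -/
def posGeom (m : R) : PowerSeries R := PowerSeries.mk fun n => if n = 0 then 0 else m ^ n

theorem posGeom_eq (m : R) : posGeom m = PowerSeries.C m * PowerSeries.X * geom m := by
  ext n
  rw [mul_assoc, PowerSeries.coeff_C_mul]
  cases n with
  | zero => simp [posGeom]
  | succ n =>
    rw [PowerSeries.coeff_succ_X_mul, posGeom, geom, PowerSeries.coeff_mk, PowerSeries.coeff_mk,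
      if_neg (by simp), pow_succ']

theorem geom_eq_one_add (m : R) : geom m = 1 + posGeom m := by
  ext n
  rw [map_add, geom, posGeom, PowerSeries.coeff_mk, PowerSeries.coeff_mk, PowerSeries.coeff_one]
  cases n <;> simp

theorem geom_mul_one_sub (m : R) :
    geom m * (1 - PowerSeries.C m * PowerSeries.X) = 1 := by
  have h := geom_eq_one_add m
  rw [posGeom_eq] at h
  linear_combination h

theorem coeff_mk_mul_mk (f g : ℕ → R) (k : ℕ) :
    PowerSeries.coeff k (PowerSeries.mk f * PowerSeries.mk g) =
      ∑ z ∈ range (k + 1), f z * g (k - z) := by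
  rw [PowerSeries.coeff_mul, Nat.sum_antidiagonal_eq_sum_range_succ
    (fun i j => PowerSeries.coeff i (PowerSeries.mk f) * PowerSeries.coeff j (PowerSeries.mk g))]
  simp

/-- A factor `geom m` puts a new upper bound `k` on a chain with top `z` and gives the gap `k - z`
the weight `m`; `posGeom` does the same for a strict inequality. -/
theorem mk_mul_geom (f : ℕ → R) (m : R) :
    PowerSeries.mk f * geom m =
      PowerSeries.mk fun k => ∑ z ∈ Icc 0 k, f z * m ^ (k - z) := by
  ext k
  rw [geom, coeff_mk_mul_mk, PowerSeries.coeff_mk, Nat.range_succ_eq_Icc_zero]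

theorem mk_mul_posGeom (f : ℕ → R) (m : R) :
    PowerSeries.mk f * posGeom m =
      PowerSeries.mk fun k => ∑ z ∈ Ico 0 k, f z * m ^ (k - z) := by
  ext k
  rw [posGeom, coeff_mk_mul_mk, PowerSeries.coeff_mk, sum_range_succ, ← Nat.Ico_zero_eq_range]
  simp only [Nat.sub_self, if_true, mul_zero, add_zero]
  refine sum_congr rfl fun z hz => ?_
  rw [mem_Ico] at hz
  rw [if_neg (by omega)]

theorem posGeom_mul_geom (m₀ m₁ : R) :
    posGeom m₀ * geom m₁ = PowerSeries.mk fun k => ∑ z ∈ Ioc 0 k, m₀ ^ z * m₁ ^ (k - z) := by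
  rw [posGeom, mk_mul_geom]
  ext k
  rw [PowerSeries.coeff_mk, PowerSeries.coeff_mk, sum_Icc_eq_add_sum_Ioc _ (Nat.zero_le k)]
  simp only [if_true, zero_mul, zero_add]
  refine sum_congr rfl fun z hz => ?_
  rw [mem_Ioc] at hz
  rw [if_neg (by omega)]

theorem posGeom_mul_posGeom (m₀ m₁ : R) :
    posGeom m₀ * posGeom m₁ = PowerSeries.mk fun k => ∑ z ∈ Ioo 0 k, m₀ ^ z * m₁ ^ (k - z) := by
  rw [posGeom, mk_mul_posGeom]
  ext k
  rw [PowerSeries.coeff_mk, PowerSeries.coeff_mk]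
  symm
  refine sum_subset_zero_on_sdiff Ioo_subset_Ico_self (fun z hz => ?_) fun z hz => ?_
  · rw [mem_sdiff, mem_Ico, mem_Ioo] at hz
    rw [if_pos (by omega), zero_mul]
  · rw [mem_Ioo] at hz
    rw [if_neg (by omega)]

end Geometric

/-! ### Generating functions of the families of chains -/

theorem qtMonomial_pow (i j n : ℕ) : qtMonomial i j ^ n = qtMonomial (i * n) (j * n) := by
  rw [qtMonomial, qtMonomial, mul_pow, ← pow_mul, ← pow_mul]

theorem qtMonomial_mul (i j i' j' : ℕ) :
    qtMonomial i j * qtMonomial i' j' = qtMonomial (i + i') (j + j') := by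
  simp only [qtMonomial]
  ring

/-- The generating function over the chains `0 ≤ a ≤ k`. -/
theorem gen_le :
    (PowerSeries.mk fun k => ∑ a ∈ Icc 0 k, qtMonomial (6 * k - 3 * a) (3 * a)) =
    geom (qtMonomial 3 3) * geom (qtMonomial 6 0) := by
  nth_rw 1 [geom]
  rw [mk_mul_geom]
  ext1 k
  simp only [PowerSeries.coeff_mk, qtMonomial_pow, qtMonomial_mul]
  refine sum_congr rfl fun a ha => ?_
  rw [mem_Icc] at ha
  congr 1 <;> omega

/-- The generating function over the chains `0 ≤ a < c ≤ k`. -/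
theorem gen_lt_le :
    (PowerSeries.mk fun k => ∑ a ∈ Icc 0 k, ∑ c ∈ Ioc a k,
      qtMonomial (6 * k - 3 * c) (2 * a + c)) =
    geom (qtMonomial 3 3) * posGeom (qtMonomial 3 1) * geom (qtMonomial 6 0) := by
  nth_rw 1 [geom]
  simp only [mk_mul_geom, mk_mul_posGeom]
  ext1 k
  simp only [PowerSeries.coeff_mk, sum_mul, sum_sigma', qtMonomial_pow, qtMonomial_mul]
  -- The product of series produces the larger chain element as the outer variable, so the order of
  -- summation is exchanged.
  refine sum_nbij' (fun x => ⟨x.2, x.1⟩) (fun x => ⟨x.2, x.1⟩) ?_ ?_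
    (fun _ _ => rfl) (fun _ _ => rfl) ?_
  · simp only [mem_sigma, mem_Icc, mem_Ico, mem_Ioc]
    omega
  · simp only [mem_sigma, mem_Icc, mem_Ico, mem_Ioc]
    omega
  · simp only [mem_sigma, mem_Icc, mem_Ioc]
    intro x hx
    congr 1 <;> omega

/-- The generating function over the chains `0 < c ≤ a ≤ k`. -/
theorem gen_pos_le_le :
    (PowerSeries.mk fun k => ∑ a ∈ Icc 0 k, ∑ c ∈ Ioc 0 a,
      qtMonomial (3 * k - 2 * c) (2 * a + k + c)) =
    posGeom (qtMonomial 1 4) * geom (qtMonomial 3 3) * geom (qtMonomial 3 1) := by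
  simp only [posGeom_mul_geom, mk_mul_geom]
  ext1 k
  simp only [PowerSeries.coeff_mk, sum_mul, sum_sigma', qtMonomial_pow, qtMonomial_mul]
  refine sum_congr rfl ?_
  simp only [mem_sigma, mem_Icc, mem_Ioc]
  intro x hx
  congr 1 <;> omega

/-- The generating function over the chains `0 ≤ a < b ≤ k`. -/
theorem gen_lt_le' :
    (PowerSeries.mk fun k => ∑ a ∈ Icc 0 k, ∑ b ∈ Ioc a k,
      qtMonomial (6 * k + a - 4 * b) (a + 2 * b)) =
    geom (qtMonomial 3 3) * posGeom (qtMonomial 2 2) * geom (qtMonomial 6 0) := by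
  nth_rw 1 [geom]
  simp only [mk_mul_geom, mk_mul_posGeom]
  ext1 k
  simp only [PowerSeries.coeff_mk, sum_mul, sum_sigma', qtMonomial_pow, qtMonomial_mul]
  refine sum_nbij' (fun x => ⟨x.2, x.1⟩) (fun x => ⟨x.2, x.1⟩) ?_ ?_
    (fun _ _ => rfl) (fun _ _ => rfl) ?_
  · simp only [mem_sigma, mem_Icc, mem_Ico, mem_Ioc]
    omega
  · simp only [mem_sigma, mem_Icc, mem_Ico, mem_Ioc]
    omega
  · simp only [mem_sigma, mem_Icc, mem_Ioc]
    intro x hx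
    congr 1 <;> omega

/-- The generating function over the chains `0 ≤ a < b < c ≤ k`. -/
theorem gen_lt_lt_le :
    (PowerSeries.mk fun k => ∑ a ∈ Icc 0 k, ∑ b ∈ Ioc a k, ∑ c ∈ Ioc b k,
      qtMonomial (6 * k + a - b - 3 * c) (a + b + c)) =
    geom (qtMonomial 3 3) * posGeom (qtMonomial 2 2) * posGeom (qtMonomial 3 1) *
      geom (qtMonomial 6 0) := by
  nth_rw 1 [geom]
  simp only [mk_mul_geom, mk_mul_posGeom]
  ext1 k
  simp only [PowerSeries.coeff_mk, sum_mul, sum_sigma', qtMonomial_pow, qtMonomial_mul]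
  refine sum_nbij' (fun x => ⟨x.2.2, x.2.1, x.1⟩) (fun x => ⟨x.2.2, x.2.1, x.1⟩) ?_ ?_
    (fun _ _ => rfl) (fun _ _ => rfl) ?_
  · simp only [mem_sigma, mem_Icc, mem_Ico, mem_Ioc]
    omega
  · simp only [mem_sigma, mem_Icc, mem_Ico, mem_Ioc]
    omega
  · simp only [mem_sigma, mem_Icc, mem_Ioc]
    intro x hx
    congr 1 <;> omega

/-- The generating function over the chains `0 < c ≤ a < b ≤ k`. -/
theorem gen_pos_le_lt_le :
    (PowerSeries.mk fun k => ∑ a ∈ Icc 0 k, ∑ b ∈ Ioc a k, ∑ c ∈ Ioc 0 a,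
      qtMonomial (3 * k + a - b - 2 * c) (a + b + k + c)) =
    posGeom (qtMonomial 1 4) * geom (qtMonomial 3 3) * posGeom (qtMonomial 2 2) *
      geom (qtMonomial 3 1) := by
  simp only [posGeom_mul_geom, mk_mul_geom, mk_mul_posGeom]
  ext1 k
  simp only [PowerSeries.coeff_mk, sum_mul, sum_sigma', qtMonomial_pow, qtMonomial_mul]
  refine sum_nbij' (fun x => ⟨x.2.1, x.1, x.2.2⟩) (fun x => ⟨x.2.1, x.1, x.2.2⟩) ?_ ?_
    (fun _ _ => rfl) (fun _ _ => rfl) ?_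
  · simp only [mem_sigma, mem_Icc, mem_Ico, mem_Ioc]
    omega
  · simp only [mem_sigma, mem_Icc, mem_Ico, mem_Ioc]
    omega
  · simp only [mem_sigma, mem_Icc, mem_Ioc]
    intro x hx
    congr 1 <;> omega

/-- The generating function over the chains `0 ≤ a < c ≤ b ≤ k`. -/
theorem gen_lt_le_le :
    (PowerSeries.mk fun k => ∑ a ∈ Icc 0 k, ∑ b ∈ Ioc a k, ∑ c ∈ Ioc a b,
      qtMonomial (3 * k - b - c) (a + b + k + c)) =
    geom (qtMonomial 1 4) * posGeom (qtMonomial 1 3) * geom (qtMonomial 2 2) *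
      geom (qtMonomial 3 1) := by
  nth_rw 1 [geom]
  simp only [mk_mul_geom, mk_mul_posGeom]
  ext1 k
  simp only [PowerSeries.coeff_mk, sum_mul, sum_sigma', qtMonomial_pow, qtMonomial_mul]
  refine sum_nbij' (fun x => ⟨x.2.1, x.2.2, x.1⟩) (fun x => ⟨x.2.2, x.1, x.2.1⟩) ?_ ?_
    (fun _ _ => rfl) (fun _ _ => rfl) ?_
  · simp only [mem_sigma, mem_Icc, mem_Ico, mem_Ioc]
    omega
  · simp only [mem_sigma, mem_Icc, mem_Ico, mem_Ioc]
    omega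
  · simp only [mem_sigma, mem_Icc, mem_Ioc]
    intro x hx
    congr 1 <;> omega

/-- The generating function over the chains `0 < b ≤ a ≤ k`. -/
theorem gen_pos_le_le' :
    (PowerSeries.mk fun k => ∑ a ∈ Icc 0 k, ∑ b ∈ Ioc 0 a,
      qtMonomial (2 * k + a - 2 * b) (a + 2 * k + 2 * b)) =
    posGeom (qtMonomial 1 5) * geom (qtMonomial 3 3) * geom (qtMonomial 2 2) := by
  simp only [posGeom_mul_geom, mk_mul_geom]
  ext1 k
  simp only [PowerSeries.coeff_mk, sum_mul, sum_sigma', qtMonomial_pow, qtMonomial_mul]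
  refine sum_congr rfl ?_
  simp only [mem_sigma, mem_Icc, mem_Ioc]
  intro x hx
  congr 1 <;> omega

/-- The generating function over the chains `0 < b < c ≤ a ≤ k`. -/
theorem gen_pos_lt_le_le :
    (PowerSeries.mk fun k => ∑ a ∈ Icc 0 k, ∑ b ∈ Ioc 0 a, ∑ c ∈ Ioc b a,
      qtMonomial (2 * k + a - 2 * c) (a + b + 2 * k + c)) =
    posGeom (qtMonomial 1 5) * posGeom (qtMonomial 1 4) * geom (qtMonomial 3 3) *
      geom (qtMonomial 2 2) := by
  simp only [posGeom_mul_posGeom, mk_mul_geom]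
  ext1 k
  simp only [PowerSeries.coeff_mk, sum_mul, sum_sigma', qtMonomial_pow, qtMonomial_mul]
  refine sum_nbij' (fun x => ⟨x.1, x.2.2, x.2.1⟩) (fun x => ⟨x.1, x.2.2, x.2.1⟩) ?_ ?_
    (fun _ _ => rfl) (fun _ _ => rfl) ?_
  · simp only [mem_sigma, mem_Icc, mem_Ioc, mem_Ioo]
    omega
  · simp only [mem_sigma, mem_Icc, mem_Ioc, mem_Ioo]
    omega
  · simp only [mem_sigma, mem_Icc, mem_Ioc]
    intro x hx
    congr 1 <;> omega

/-- The generating function over the chains `0 < b ≤ a < c ≤ k`. -/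
theorem gen_pos_le_lt_le' :
    (PowerSeries.mk fun k => ∑ a ∈ Icc 0 k, ∑ b ∈ Ioc 0 a, ∑ c ∈ Ioc a k,
      qtMonomial (2 * k - c) (a + b + 2 * k + c)) =
    posGeom (qtMonomial 1 5) * geom (qtMonomial 1 4) * posGeom (qtMonomial 1 3) *
      geom (qtMonomial 2 2) := by
  simp only [posGeom_mul_geom, mk_mul_geom, mk_mul_posGeom]
  ext1 k
  simp only [PowerSeries.coeff_mk, sum_mul, sum_sigma', qtMonomial_pow, qtMonomial_mul]
  refine sum_nbij' (fun x => ⟨x.2.2, x.1, x.2.1⟩) (fun x => ⟨x.2.1, x.2.2, x.1⟩) ?_ ?_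
    (fun _ _ => rfl) (fun _ _ => rfl) ?_
  · simp only [mem_sigma, mem_Icc, mem_Ico, mem_Ioc]
    omega
  · simp only [mem_sigma, mem_Icc, mem_Ico, mem_Ioc]
    omega
  · simp only [mem_sigma, mem_Icc, mem_Ioc]
    intro x hx
    congr 1 <;> omega

/-- The generating function over the chains `0 < c ≤ b ≤ a ≤ k`. -/
theorem gen_pos_le_le_le :
    (PowerSeries.mk fun k => ∑ a ∈ Icc 0 k, ∑ b ∈ Ioc 0 a, ∑ c ∈ Ioc 0 b,
      qtMonomial (k - c) (a + b + 3 * k + c)) =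
    posGeom (qtMonomial 0 6) * geom (qtMonomial 1 5) * geom (qtMonomial 1 4) *
      geom (qtMonomial 1 3) := by
  simp only [posGeom_mul_geom, mk_mul_geom]
  ext1 k
  simp only [PowerSeries.coeff_mk, sum_mul, sum_sigma', qtMonomial_pow, qtMonomial_mul]
  refine sum_nbij' (fun x => x) (fun x => x) ?_ ?_
    (fun _ _ => rfl) (fun _ _ => rfl) ?_
  · simp only [mem_sigma, mem_Icc, mem_Ioc]
    omega
  · simp only [mem_sigma, mem_Icc, mem_Ioc]
    omega
  · simp only [mem_sigma, mem_Icc, mem_Ioc]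
    intro x hx
    congr 1 <;> omega

/-! ### Summation to a rational function -/

theorem genFun_eq :
    genFun =
      geom (qtMonomial 3 3) * geom (qtMonomial 6 0) +
      PowerSeries.C (1 + q + q ^ 2) *
        (geom (qtMonomial 3 3) * posGeom (qtMonomial 3 1) * geom (qtMonomial 6 0)) +
      PowerSeries.C (1 + q) *
        (posGeom (qtMonomial 1 4) * geom (qtMonomial 3 3) * geom (qtMonomial 3 1)) +
      PowerSeries.C (1 + q + q ^ 2) *
        (geom (qtMonomial 3 3) * posGeom (qtMonomial 2 2) * geom (qtMonomial 6 0)) +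
      PowerSeries.C ((1 + q) * (1 + q + q ^ 2)) *
        (geom (qtMonomial 3 3) * posGeom (qtMonomial 2 2) * posGeom (qtMonomial 3 1) *
          geom (qtMonomial 6 0)) +
      PowerSeries.C ((1 + q) ^ 2) *
        (posGeom (qtMonomial 1 4) * geom (qtMonomial 3 3) * posGeom (qtMonomial 2 2) *
          geom (qtMonomial 3 1)) +
      PowerSeries.C (1 + q) *
        (geom (qtMonomial 1 4) * posGeom (qtMonomial 1 3) * geom (qtMonomial 2 2) *
          geom (qtMonomial 3 1)) +
      posGeom (qtMonomial 1 5) * geom (qtMonomial 3 3) * geom (qtMonomial 2 2) +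
      PowerSeries.C (1 + q) *
        (posGeom (qtMonomial 1 5) * posGeom (qtMonomial 1 4) * geom (qtMonomial 3 3) *
          geom (qtMonomial 2 2)) +
      posGeom (qtMonomial 1 5) * geom (qtMonomial 1 4) * posGeom (qtMonomial 1 3) *
        geom (qtMonomial 2 2) +
      posGeom (qtMonomial 0 6) * geom (qtMonomial 1 5) * geom (qtMonomial 1 4) *
        geom (qtMonomial 1 3) := by
  rw [← gen_le, ← gen_lt_le, ← gen_pos_le_le, ← gen_lt_le', ← gen_lt_lt_le,
    ← gen_pos_le_lt_le, ← gen_lt_le_le, ← gen_pos_le_le',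
    ← gen_pos_lt_le_le, ← gen_pos_le_lt_le', ← gen_pos_le_le_le]
  ext1 k
  simp only [genFun, LinearMap.map_add, PowerSeries.coeff_C_mul, PowerSeries.coeff_mk]
  rw [qtCatalan_replicate_four_eq_sum_weight]
  have h : ∀ a ∈ Icc 0 k, _ := fun a ha =>
    congrArg₂ (· + ·) (congrArg₂ (· + ·) (sum_weight_left (mem_Icc.1 ha).2)
      (sum_congr rfl fun b hb =>
        sum_weight_middle (k := k) (a := a) (mem_Ioc.1 hb).1 (mem_Ioc.1 hb).2))
      (sum_congr rfl fun b hb =>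
        sum_weight_right (mem_Icc.1 ha).2 (mem_Ioc.1 hb).1 (mem_Ioc.1 hb).2)
  refine (sum_congr rfl h).trans ?_
  simp only [sum_add_distrib, mul_sum]
  abel

/-- The sum of the generating functions over the cells is the rational function in question. Here
each `g` stands for the inverse of `1 - m * x` for each of the eight monomials `m` that occur. -/
theorem rational_identity {K : Type*} [Field K]
    {q t x g000 g111 g001 g112 g011 g012 g122 g123 : K}
    (h000 : g000 * (1 - q ^ 6 * x) = 1)
    (h111 : g111 * (1 - q ^ 3 * t ^ 3 * x) = 1)
    (h001 : g001 * (1 - q ^ 3 * t * x) = 1)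
    (h112 : g112 * (1 - q * t ^ 4 * x) = 1)
    (h011 : g011 * (1 - q ^ 2 * t ^ 2 * x) = 1)
    (h012 : g012 * (1 - q * t ^ 3 * x) = 1)
    (h122 : g122 * (1 - q * t ^ 5 * x) = 1)
    (h123 : g123 * (1 - t ^ 6 * x) = 1) :
    (g111 * g000 +
      (1 + q + q ^ 2) * (g111 * (q ^ 3 * t * x * g001) * g000) +
      (1 + q) * ((q * t ^ 4 * x * g112) * g111 * g001) +
      (1 + q + q ^ 2) * (g111 * (q ^ 2 * t ^ 2 * x * g011) * g000) +
      (1 + q) * (1 + q + q ^ 2) *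
        (g111 * (q ^ 2 * t ^ 2 * x * g011) * (q ^ 3 * t * x * g001) * g000) +
      (1 + q) ^ 2 * ((q * t ^ 4 * x * g112) * g111 * (q ^ 2 * t ^ 2 * x * g011) * g001) +
      (1 + q) * (g112 * (q * t ^ 3 * x * g012) * g011 * g001) +
      (q * t ^ 5 * x * g122) * g111 * g011 +
      (1 + q) * ((q * t ^ 5 * x * g122) * (q * t ^ 4 * x * g112) * g111 * g011) +
      (q * t ^ 5 * x * g122) * g112 * (q * t ^ 3 * x * g012) * g011 +
      (t ^ 6 * x * g123) * g122 * g112 * g012) *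
    ((1 - q ^ 3 * t * x) * (1 - q ^ 2 * t ^ 2 * x) * (1 - q * t ^ 3 * x) * (1 - q ^ 6 * x) *
      (1 - t ^ 6 * x)) =
    1 + (q ^ 5 * t + q ^ 4 * t ^ 2 + q ^ 3 * t ^ 3 + q ^ 2 * t ^ 4 + q * t ^ 5
      + q ^ 4 * t + q ^ 3 * t ^ 2 + q ^ 2 * t ^ 3 + q * t ^ 4) * x
    + (q ^ 6 * t ^ 5 + q ^ 5 * t ^ 6 - q ^ 7 * t ^ 3 - q ^ 6 * t ^ 4 - q ^ 5 * t ^ 5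
      - q ^ 4 * t ^ 6 - q ^ 3 * t ^ 7 - q ^ 5 * t ^ 4 - q ^ 4 * t ^ 5) * x ^ 2
    - (q ^ 8 * t ^ 8 + q ^ 9 * t ^ 6 + q ^ 8 * t ^ 7 + q ^ 7 * t ^ 8 + q ^ 6 * t ^ 9) * x ^ 3 := by
  -- The digits in `g…` are the stages `l₂ l₃ l₄` of a path with `k = 1` whose monomial is `m`;
  -- their sum is the exponent of `t`.
  have n000 := right_ne_zero_of_mul_eq_one h000
  have n111 := right_ne_zero_of_mul_eq_one h111
  have n001 := right_ne_zero_of_mul_eq_one h001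
  have n112 := right_ne_zero_of_mul_eq_one h112
  have n011 := right_ne_zero_of_mul_eq_one h011
  have n012 := right_ne_zero_of_mul_eq_one h012
  have n122 := right_ne_zero_of_mul_eq_one h122
  have n123 := right_ne_zero_of_mul_eq_one h123
  rw [eq_inv_of_mul_eq_one_left h000]
  rw [eq_inv_of_mul_eq_one_left h111]
  rw [eq_inv_of_mul_eq_one_left h001]
  rw [eq_inv_of_mul_eq_one_left h112]
  rw [eq_inv_of_mul_eq_one_left h011]
  rw [eq_inv_of_mul_eq_one_left h012]
  rw [eq_inv_of_mul_eq_one_left h122]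
  rw [eq_inv_of_mul_eq_one_left h123]
  -- The poles belonging to `g111`, `g112` and `g122` cancel in the sum.
  field_simp
  ring

theorem geom_qtMonomial_mul (i j : ℕ) :
    geom (qtMonomial i j) *
      (1 - PowerSeries.C q ^ i * PowerSeries.C t ^ j * PowerSeries.X) = 1 := by
  have h := geom_mul_one_sub (qtMonomial i j)
  rwa [qtMonomial, map_mul, map_pow, map_pow] at h

theorem coe_factor (i j : ℕ) :
    (factor i j : PowerSeries (MvPolynomial (Fin 2) ℤ)) =
      1 - PowerSeries.C q ^ i * PowerSeries.C t ^ j * PowerSeries.X := by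
  simp [factor]

theorem coe_denominator :
    (denominator : PowerSeries (MvPolynomial (Fin 2) ℤ)) =
      (factor 3 1 : PowerSeries (MvPolynomial (Fin 2) ℤ)) *
        (factor 2 2 : PowerSeries (MvPolynomial (Fin 2) ℤ)) *
        (factor 1 3 : PowerSeries (MvPolynomial (Fin 2) ℤ)) *
        (factor 6 0 : PowerSeries (MvPolynomial (Fin 2) ℤ)) *
        (factor 0 6 : PowerSeries (MvPolynomial (Fin 2) ℤ)) := by
  simp only [denominator, Polynomial.coe_mul]

theorem genFun_mul_denominator :
    genFun * (denominator : PowerSeries (MvPolynomial (Fin 2) ℤ)) =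
      (numerator : PowerSeries (MvPolynomial (Fin 2) ℤ)) := by
  -- Power series over a domain form a domain, so the identity may be checked in the fraction field.
  apply IsFractionRing.injective (PowerSeries (MvPolynomial (Fin 2) ℤ))
    (FractionRing (PowerSeries (MvPolynomial (Fin 2) ℤ)))
  have h (i j : ℕ) := congrArg (algebraMap (PowerSeries (MvPolynomial (Fin 2) ℤ))
    (FractionRing (PowerSeries (MvPolynomial (Fin 2) ℤ)))) (geom_qtMonomial_mul i j)
  simp only [map_mul, map_sub, map_one, map_pow] at h
  have key := rational_identity (by simpa using h 6 0) (h 3 3) (by simpa using h 3 1)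
    (by simpa using h 1 4) (h 2 2) (by simpa using h 1 3) (by simpa using h 1 5)
    (by simpa using h 0 6)
  rw [genFun_eq, coe_denominator]
  simp only [posGeom_eq, coe_factor, numerator, Polynomial.coe_add, Polynomial.coe_sub,
    Polynomial.coe_mul, Polynomial.coe_C, Polynomial.coe_X, Polynomial.coe_pow, Polynomial.coe_one,
    qtMonomial, map_mul, map_add, map_sub, map_one, map_pow, pow_zero, pow_one, one_mul, mul_one]
    at key ⊢
  exact key

/-! ### Symmetry in `q` and `t` -/

theorem map_swap_denominator :
    denominator.map (MvPolynomial.rename (R := ℤ) (Equiv.swap (0 : Fin 2) 1)).toRingHom =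
      denominator := by
  have hf (i j : ℕ) : (factor i j).map
      (MvPolynomial.rename (R := ℤ) (Equiv.swap (0 : Fin 2) 1)).toRingHom = factor j i := by
    simp [factor, q, t, mul_comm]
  rw [denominator]
  simp only [Polynomial.map_mul, hf]
  ring

theorem map_swap_numerator :
    numerator.map (MvPolynomial.rename (R := ℤ) (Equiv.swap (0 : Fin 2) 1)).toRingHom =
      numerator := by
  simp only [numerator, q, t, Polynomial.map_add, Polynomial.map_sub, Polynomial.map_mul,
    Polynomial.map_pow, Polynomial.map_one, Polynomial.map_X, Polynomial.map_C,
    AlgHom.toRingHom_eq_coe, RingHom.coe_coe, map_add, map_sub, map_mul, map_pow,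
    MvPolynomial.rename_X,
    Equiv.swap_apply_left, Equiv.swap_apply_right]
  ring

/-- The swapped series has the same product with the denominator, which can be cancelled because its
constant term is `1`. -/
theorem map_swap_genFun :
    genFun.map (MvPolynomial.rename (R := ℤ) (Equiv.swap (0 : Fin 2) 1)).toRingHom = genFun := by
  have h := congrArg (PowerSeries.map
    (MvPolynomial.rename (R := ℤ) (Equiv.swap (0 : Fin 2) 1)).toRingHom) genFun_mul_denominator
  rw [map_mul, ← Polynomial.polynomial_map_coe, ← Polynomial.polynomial_map_coe,
    map_swap_denominator, map_swap_numerator, ← genFun_mul_denominator] at h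
  refine mul_right_cancel₀ ?_ h
  intro h0
  have := congrArg PowerSeries.constantCoeff h0
  simp [coe_denominator, coe_factor] at this

end QTCatalan

theorem mainTheorem5 :
    (∀ k : ℕ, QTCatalan.swapQT (QTCatalan.qtCatalan (List.replicate 4 k)) =
      QTCatalan.qtCatalan (List.replicate 4 k)) ∧
    QTCatalan.genFun * (QTCatalan.denominator : PowerSeries (MvPolynomial (Fin 2) ℤ)) =
      (QTCatalan.numerator : PowerSeries (MvPolynomial (Fin 2) ℤ)) := by
  refine ⟨fun k => ?_, QTCatalan.genFun_mul_denominator⟩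
  have h := congrArg (PowerSeries.coeff k) QTCatalan.map_swap_genFun
  rw [PowerSeries.coeff_map, QTCatalan.genFun, PowerSeries.coeff_mk] at h
  exact h
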